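/- Two nodes $A$ and $B$ exchange messages through a relay $R$; there is no direct link between $A$ and $B$. Fix a power $P\ge 0$ and a noise level $\sigma>0$. A code with block length $n$ for $k$ bits works as follows. The messages $\mathbf u_A,\mathbf u_B$ are independent and uniform on $\{0,1\}^k$. The nodes may use a random seed $W$, visible to all three of them and independent of the messages and the noises. *MAC phase* ($n$ channel uses): $A$ sends $\mathbf x_1\in\mathbb R^n$, a function of $(W,\mathbf u_A)$; $B$ sends $\mathbf x_2\in\mathbb R^n$, a function of $(W,\mathbf u_B)$; the relay receives $\mathbf y_R=\mathbf x_1+\mathbf x_2+\mathbf z_R$. *Broadcast phase* ($n$ further channel uses, orthogonal to the MAC phase): the relay sends $\mathbf x_R\in\mathbb R^n$, a function of $(W,\mathbf y_R)$; node $A$ receives $\mathbf y_A=\mathbf x_R+\mathbf z_A$ and forms an estimate $\hat{\mathbf u}_B$ from $(W,\mathbf u_A,\mathbf y_A)$; node $B$ receives $\mathbf y_B=\mathbf x_R+\mathbf z_B$ and forms an estimate $\hat{\mathbf u}_A$ from $(W,\mathbf u_B,\mathbf y_B)$. All these functions are measurable. The noise vectors $\mathbf z_R,\mathbf z_A,\mathbf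 z_B$ are independent, each with i.i.d. $\mathcal N(0,\sigma^2)$ entries, and are independent of the messages. The code has to satisfy $E\|\mathbf x_1\|^2\le nP$, $E\|\mathbf x_2\|^2\le nP$ and $E\|\mathbf x_R\|^2\le nP$. Its error probability is $P_e=\Pr(\{\mathbf u_A\ne\hat{\mathbf u}_A\}\cup\{\mathbf u_B\ne\hat{\mathbf u}_B\})$. A scheme consists of one such code for every pair $(n,k)$. Its exchange rate is the supremum of $\liminf_{n\to\infty} k_n/n$ over all sequences $(k_n)$ for which the error probability of its code for $(n,k_n)$ tends to $0$ as $n\to\infty$. The exchange capacity $C_{ex}$ is the supremum of the exchange rates of all schemes. Then $$C_{ex}\le \tfrac12\log_2\left(1+\frac{P}{\sigma^2}\right).$$ -/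

import Mathlib

open MeasureTheory ProbabilityTheory Filter Topology

namespace BidirectionalRelay

/-- Information vectors in `{0,1}^k`. -/
abbrev Msg (k : ℕ) : Type := Fin k → Bool

/-- Real signal vectors: one block of `n` channel uses. -/
abbrev Signal (n : ℕ) : Type := Fin n → ℝ

/-- The energy `‖x‖² = ∑ i, x i ^ 2` (squared Euclidean norm) as an extended nonnegative real. -/
noncomputable def energy {n : ℕ} (x : Signal n) : ENNReal := ENNReal.ofReal (∑ i, x i ^ 2)

/-- `k` independent fair bits. -/
noncomputable def msgLaw (k : ℕ) : Measure (Msg k) := (PMF.uniformOfFintype (Msg k)).toMeasure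

/-- White Gaussian noise: `n` i.i.d. centred Gaussian coordinates of variance `σ ^ 2`. -/
noncomputable def noiseLaw (n : ℕ) (σ : ℝ) : Measure (Signal n) :=
  Measure.pi fun _ => gaussianReal 0 (σ ^ 2).toNNReal

/-- A two-phase code exchanging `k` bits in each direction with `n` uses of the MAC channel followed
by `n` uses of the broadcast channel. Nodes may randomize: the random seed is independent of the
messages and of the noise, and all three nodes see it (as with a dither). A node that ignores a
component of the seed leaves it as private randomness of the others, and a one-point `Seed` gives
deterministic codes. Nodes `A` and `B` have no other link than the one through the relay: `x₁` and
`x₂` depend on the own message only, the relay on its received block only, and each decoder on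
the own message and the block received in the broadcast phase. -/
structure ExchangeCode (n k : ℕ) where
  /-- The alphabet of the random seed. -/
  Seed : Type
  /-- Its σ-algebra. -/
  seedSpace : MeasurableSpace Seed
  /-- The law of the seed. -/
  seedLaw : Measure Seed
  seedLaw_prob : IsProbabilityMeasure seedLaw
  /-- Encoder of node `A`. -/
  encA : Seed → Msg k → Signal n
  /-- Encoder of node `B`. -/
  encB : Seed → Msg k → Signal n
  /-- The map by which the relay turns the block it received into the block it transmits. -/
  relay : Seed → Signal n → Signal n
  /-- Decoder of node `A`: own message and received block give an estimate of the message of `B`. -/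
  decA : Seed → Msg k → Signal n → Msg k
  /-- Decoder of node `B`: own message and received block give an estimate of the message of `A`. -/
  decB : Seed → Msg k → Signal n → Msg k
  measurable_encA : Measurable fun p : Seed × Msg k => encA p.1 p.2
  measurable_encB : Measurable fun p : Seed × Msg k => encB p.1 p.2
  measurable_relay : Measurable fun p : Seed × Signal n => relay p.1 p.2
  measurable_decA : Measurable fun p : Seed × Msg k × Signal n => decA p.1 p.2.1 p.2.2
  measurable_decB : Measurable fun p : Seed × Msg k × Signal n => decB p.1 p.2.1 p.2.2

attribute [instance] ExchangeCode.seedSpace ExchangeCode.seedLaw_prob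

namespace ExchangeCode

variable {n k : ℕ} (c : ExchangeCode n k)

/-- The sample space: seed, the two messages, the noise at the relay (MAC phase), and the noises
at `A` and at `B` (broadcast phase). -/
abbrev Outcome : Type :=
  c.Seed × (Msg k × Msg k) × Signal n × Signal n × Signal n

/-- Seed, messages and noises are all independent. -/
noncomputable def law (σ : ℝ) : Measure c.Outcome :=
  c.seedLaw.prod (((msgLaw k).prod (msgLaw k)).prod
    ((noiseLaw n σ).prod ((noiseLaw n σ).prod (noiseLaw n σ))))

/-- The seed. -/
def seed (ω : c.Outcome) : c.Seed := ω.1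

/-- The message of node `A`. -/
def uA (ω : c.Outcome) : Msg k := ω.2.1.1

/-- The message of node `B`. -/
def uB (ω : c.Outcome) : Msg k := ω.2.1.2

/-- The noise at the relay. -/
def zR (ω : c.Outcome) : Signal n := ω.2.2.1

/-- The noise at node `A`. -/
def zA (ω : c.Outcome) : Signal n := ω.2.2.2.1

/-- The noise at node `B`. -/
def zB (ω : c.Outcome) : Signal n := ω.2.2.2.2

/-- The block transmitted by node `A` in the MAC phase. -/
def x₁ (ω : c.Outcome) : Signal n := c.encA (c.seed ω) (c.uA ω)

/-- The block transmitted by node `B` in the MAC phase. -/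
def x₂ (ω : c.Outcome) : Signal n := c.encB (c.seed ω) (c.uB ω)

/-- The block received by the relay in the MAC phase. -/
def yR (ω : c.Outcome) : Signal n := c.x₁ ω + c.x₂ ω + c.zR ω

/-- The block transmitted by the relay in the broadcast phase. -/
def xR (ω : c.Outcome) : Signal n := c.relay (c.seed ω) (c.yR ω)

/-- The block received by node `A` in the broadcast phase. -/
def yA (ω : c.Outcome) : Signal n := c.xR ω + c.zA ω

/-- The block received by node `B` in the broadcast phase. -/
def yB (ω : c.Outcome) : Signal n := c.xR ω + c.zB ω

/-- The estimate, at node `A`, of the message of node `B`. -/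
def estB (ω : c.Outcome) : Msg k := c.decA (c.seed ω) (c.uA ω) (c.yA ω)

/-- The estimate, at node `B`, of the message of node `A`. -/
def estA (ω : c.Outcome) : Msg k := c.decB (c.seed ω) (c.uB ω) (c.yB ω)

/-- The average power constraints `E‖x₁‖² ≤ nP`, `E‖x₂‖² ≤ nP`, `E‖x_R‖² ≤ nP`. -/
def PowerConstrained (P σ : ℝ) : Prop :=
  ∫⁻ ω, energy (c.x₁ ω) ∂c.law σ ≤ ENNReal.ofReal (n * P) ∧
  ∫⁻ ω, energy (c.x₂ ω) ∂c.law σ ≤ ENNReal.ofReal (n * P) ∧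
  ∫⁻ ω, energy (c.xR ω) ∂c.law σ ≤ ENNReal.ofReal (n * P)

/-- The probability that at least one of the two messages is estimated wrongly. -/
noncomputable def errorProb (σ : ℝ) : ENNReal :=
  c.law σ ({ω | c.uA ω ≠ c.estA ω} ∪ {ω | c.uB ω ≠ c.estB ω})

end ExchangeCode

/-- An encoding/decoding scheme: for each block length `n` and each number `k` of information bits
a code that meets the power constraints. -/
structure Scheme (P σ : ℝ) where
  /-- The code used for `k` bits and block length `n`. -/
  code : ∀ n k : ℕ, ExchangeCode n k
  power : ∀ n k : ℕ, (code n k).PowerConstrained P σ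

/-- The exchange rate of a scheme: the largest `k / n` (asymptotically, in bits per node and
channel use of each phase) over all choices of `k = k n` for which the error probability
tends to `0` as `n → ∞`. -/
noncomputable def Scheme.exchangeRate {P σ : ℝ} (S : Scheme P σ) : EReal :=
  ⨆ (k : ℕ → ℕ) (_ : Tendsto (fun n => (S.code n (k n)).errorProb σ) atTop (𝓝 0)),
    liminf (fun n : ℕ => (((k n : ℝ) / (n : ℝ) : ℝ) : EReal)) atTop

/-- The exchange capacity: the supremum of the exchange rates of all schemes. -/
noncomputable def exchangeCapacity (P σ : ℝ) : EReal :=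
  ⨆ S : Scheme P σ, S.exchangeRate

end BidirectionalRelay

/-!
The bound is the weak converse for one link only, the broadcast link from the relay to node `B`.
Node `B` has to recover the `k` uniform bits of `A` from the seed, its own message (both independent
of those bits) and the received block `x + z`, where the input `x` of the link depends on everything
upstream and has expected energy at most `n P`.

Instead of mutual information and Fano's inequality, the proof changes the measure of the received
block. For an input `x` the noise `z` has an explicit log-likelihood ratio `L (x, z)`, the sum of
`infoDensity`, between the law of `x + z` and white Gaussian noise of variance `σ ^ 2 + P`. Weighting
by `exp (-L)` makes the received block independent of all upstream data
(`lintegral_exp_neg_infoDensity`), so that node `B` can only guess and succeeds with probability at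
most `2⁻ᵏ` (`ExchangeCode.upstreamLaw_guess_le`). Hence, with `f = k log 2` on correct decisions and
`f = 0` elsewhere, `E exp (f - L) ≤ 1 + 2ᵏ 2⁻ᵏ = 2`, and convexity of `exp` gives
`E f ≤ E L + log 2` (`log_mul_measureReal_le`). The power constraint gives
`E L ≤ (n / 2) log (1 + P / σ ^ 2)` (`integral_sum_infoDensity_le`). Together,
`k (1 - P_e) ≤ (n / 2) log₂ (1 + P / σ ^ 2) + 1` for every code
(`ExchangeCode.mul_one_sub_errorProb_le`), and the theorem follows on dividing by `n`.
-/

namespace BidirectionalRelay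

/-! ### Gaussian change of measure -/

/-- A product of measures with real densities has the product density. -/
lemma pi_withDensity_ofReal {n : ℕ} {f : ℝ → ℝ} (hf : Integrable f) (hf0 : ∀ t, 0 ≤ f t)
    [SigmaFinite (volume.withDensity fun t => ENNReal.ofReal (f t))] :
    (Measure.pi fun _ : Fin n => volume.withDensity fun t => ENNReal.ofReal (f t)) =
      (volume : Measure (Signal n)).withDensity fun x => ENNReal.ofReal (∏ i, f (x i)) := by
  refine Measure.pi_eq fun s hs => ?_
  have hs' : MeasurableSet (Set.univ.pi s) := MeasurableSet.univ_pi hs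
  rw [withDensity_apply _ hs', ← lintegral_indicator hs']
  have hind : ∀ x : Signal n,
      (Set.univ.pi s).indicator (fun x => ENNReal.ofReal (∏ i, f (x i))) x
        = ENNReal.ofReal (∏ i, (s i).indicator f (x i)) := by
    intro x
    by_cases hx : x ∈ Set.univ.pi s
    · rw [Set.indicator_of_mem hx]
      congr 1
      refine Finset.prod_congr rfl fun i _ => ?_
      rw [Set.indicator_of_mem (hx i (Set.mem_univ i))]
    · rw [Set.indicator_of_notMem hx]
      obtain ⟨i, hi⟩ : ∃ i, x i ∉ s i := by simpa [Set.mem_pi] using hx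
      rw [Finset.prod_eq_zero (Finset.mem_univ i) (Set.indicator_of_notMem hi f),
        ENNReal.ofReal_zero]
  have hint : ∀ i, Integrable ((s i).indicator f) := fun i => hf.indicator (hs i)
  have hnn : ∀ i t, 0 ≤ (s i).indicator f t := fun i t => Set.indicator_nonneg (fun t _ => hf0 t) t
  simp_rw [hind]
  rw [volume_pi, ← ofReal_integral_eq_lintegral_ofReal (Integrable.fintype_prod hint)
    (Eventually.of_forall fun x => Finset.prod_nonneg fun i _ => hnn i _),
    integral_fintype_prod_eq_prod (fun i => (s i).indicator f),
    ENNReal.ofReal_prod_of_nonneg fun i _ => integral_nonneg (hnn i)]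
  refine Finset.prod_congr rfl fun i _ => ?_
  rw [withDensity_apply _ (hs i), ← lintegral_indicator (hs i),
    ofReal_integral_eq_lintegral_ofReal (hint i) (Eventually.of_forall (hnn i))]
  refine lintegral_congr fun t => ?_
  by_cases ht : t ∈ s i <;> simp [ht]

/-- White Gaussian noise with `n` coordinates of variance `v`. -/
noncomputable abbrev whiteNoise (n : ℕ) (v : NNReal) : Measure (Signal n) :=
  Measure.pi fun _ => gaussianReal 0 v

lemma whiteNoise_eq_withDensity (n : ℕ) {v : NNReal} (hv : v ≠ 0) :
    whiteNoise n v = (volume : Measure (Signal n)).withDensity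
      fun x => ENNReal.ofReal (∏ i, gaussianPDFReal 0 v (x i)) := by
  have h := gaussianReal_of_var_ne_zero 0 hv
  have : SigmaFinite (volume.withDensity fun t => ENNReal.ofReal (gaussianPDFReal 0 v t)) := by
    change SigmaFinite (volume.withDensity (gaussianPDF 0 v))
    rw [← h]
    infer_instance
  rw [← pi_withDensity_ofReal (integrable_gaussianPDFReal 0 v) (gaussianPDFReal_nonneg 0 v),
    whiteNoise, h]
  rfl

lemma lintegral_whiteNoise {n : ℕ} {v : NNReal} (hv : v ≠ 0) (g : Signal n → ENNReal)
    (hg : Measurable g) :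
    ∫⁻ z, g z ∂whiteNoise n v = ∫⁻ z, ENNReal.ofReal (∏ i, gaussianPDFReal 0 v (z i)) * g z := by
  have hm : Measurable fun x : Signal n => ENNReal.ofReal (∏ i, gaussianPDFReal 0 v (x i)) := by
    refine ENNReal.measurable_ofReal.comp (Finset.measurable_prod _ fun i _ => ?_)
    exact (measurable_gaussianPDFReal 0 v).comp (measurable_pi_apply i)
  rw [whiteNoise_eq_withDensity n hv, lintegral_withDensity_eq_lintegral_mul _ hm hg]
  rfl

/-- The information density of one use of the channel: the logarithm of the density of the output
`x + z` given the input `x`, at noise variance `v`, relative to the centred Gaussian density of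
variance `w`. -/
noncomputable def infoDensity (v w : NNReal) (x z : ℝ) : ℝ :=
  1 / 2 * Real.log (w / v) - z ^ 2 / (2 * v) + (x + z) ^ 2 / (2 * w)

lemma exp_neg_infoDensity_mul {v w : NNReal} (hv : v ≠ 0) (hw : w ≠ 0) (x z : ℝ) :
    Real.exp (-infoDensity v w x z) * gaussianPDFReal 0 v z = gaussianPDFReal 0 w (x + z) := by
  have hv' : (0 : ℝ) < v := by positivity
  have hw' : (0 : ℝ) < w := by positivity
  have hlog : ∀ a : ℝ, 0 < a → (√(2 * Real.pi * a))⁻¹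
      = Real.exp (-(1 / 2 * Real.log (2 * Real.pi) + 1 / 2 * Real.log a)) := by
    intro a ha
    have hpi := Real.pi_pos
    rw [Real.exp_neg, Real.sqrt_eq_rpow, Real.rpow_def_of_pos (by positivity),
      Real.log_mul (by positivity) ha.ne']
    congr 2
    ring
  rw [gaussianPDFReal, gaussianPDFReal, hlog _ hv', hlog _ hw', ← Real.exp_add, ← Real.exp_add,
    ← Real.exp_add, infoDensity, Real.log_div hw'.ne' hv'.ne']
  congr 1
  ring

lemma measurable_infoDensity (v w : NNReal) :
    Measurable fun p : ℝ × ℝ => infoDensity v w p.1 p.2 := by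
  unfold infoDensity
  fun_prop

lemma measurable_sum_infoDensity {Ω : Type*} [MeasurableSpace Ω] {n : ℕ} (v w : NNReal)
    {X Z : Ω → Signal n} (hX : Measurable X) (hZ : Measurable Z) :
    Measurable fun ω => ∑ i, infoDensity v w (X ω i) (Z ω i) :=
  Finset.measurable_sum _ fun i _ => (measurable_infoDensity v w).comp
    (((measurable_pi_apply i).comp hX).prodMk ((measurable_pi_apply i).comp hZ))

/-- Weighting the output of the channel with input `x` by `exp (-∑ infoDensity)` turns its law into
white Gaussian noise of variance `w`, whatever the input is. -/
lemma lintegral_exp_neg_infoDensity {n : ℕ} {v w : NNReal} (hv : v ≠ 0) (hw : w ≠ 0)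
    (x : Signal n) (g : Signal n → ENNReal) (hg : Measurable g) :
    ∫⁻ z, g (x + z) * ENNReal.ofReal (Real.exp (-∑ i, infoDensity v w (x i) (z i)))
        ∂whiteNoise n v = ∫⁻ y, g y ∂whiteNoise n w := by
  have hm : Measurable fun z : Signal n =>
      ENNReal.ofReal (Real.exp (-∑ i, infoDensity v w (x i) (z i))) := by
    have h := measurable_sum_infoDensity v w (measurable_const (a := x)) measurable_id
    exact ENNReal.measurable_ofReal.comp (Real.measurable_exp.comp h.neg)
  have hgx : Measurable fun z => g (x + z) := hg.comp (measurable_const_add x)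
  rw [lintegral_whiteNoise hv (fun z => g (x + z) * _) (hgx.mul hm),
    lintegral_whiteNoise hw g hg,
    ← lintegral_add_left_eq_self
      (fun y : Signal n => ENNReal.ofReal (∏ i, gaussianPDFReal 0 w (y i)) * g y) x]
  refine lintegral_congr fun z => ?_
  have hprod : Real.exp (-∑ i, infoDensity v w (x i) (z i)) * ∏ i, gaussianPDFReal 0 v (z i)
      = ∏ i, gaussianPDFReal 0 w ((x + z) i) := by
    rw [← Finset.sum_neg_distrib, Real.exp_sum, ← Finset.prod_mul_distrib]
    exact Finset.prod_congr rfl fun i _ => exp_neg_infoDensity_mul hv hw _ _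
  rw [← hprod, ENNReal.ofReal_mul (Real.exp_pos _).le]
  ring

/-! ### The expected information density under a power constraint -/

variable {Ω : Type*} [MeasurableSpace Ω]

lemma integrable_sq_whiteNoise {n : ℕ} (v : NNReal) (i : Fin n) :
    Integrable (fun z : Signal n => z i ^ 2) (whiteNoise n v) :=
  integrable_comp_eval (μ := fun _ : Fin n => gaussianReal 0 v) (f := fun t : ℝ => t ^ 2)
    (memLp_id_gaussianReal 2).integrable_sq

lemma integral_sq_whiteNoise {n : ℕ} (v : NNReal) (i : Fin n) :
    ∫ z : Signal n, z i ^ 2 ∂whiteNoise n v = v := by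
  rw [integral_comp_eval (μ := fun _ : Fin n => gaussianReal 0 v) (f := fun t : ℝ => t ^ 2)
    (by fun_prop)]
  have h := variance_eq_integral (μ := gaussianReal 0 v) (X := fun t => t) aemeasurable_id
  rw [variance_fun_id_gaussianReal, integral_id_gaussianReal] at h
  simpa using h.symm

lemma integral_eval_whiteNoise {n : ℕ} (v : NNReal) (i : Fin n) :
    ∫ z : Signal n, z i ∂whiteNoise n v = 0 := by
  rw [integral_comp_eval (μ := fun _ : Fin n => gaussianReal 0 v) (f := fun t : ℝ => t)
    (by fun_prop)]
  exact integral_id_gaussianReal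

lemma integrable_eval_whiteNoise {n : ℕ} (v : NNReal) (i : Fin n) :
    Integrable (fun z : Signal n => z i) (whiteNoise n v) :=
  integrable_comp_eval (μ := fun _ : Fin n => gaussianReal 0 v) (f := fun t : ℝ => t)
    ((memLp_id_gaussianReal 1).integrable le_rfl)

/-- Integrability and mean of the information density in coordinate `i`: the mean square of the
output is that of the input plus `v`, since the noise is centred and independent of the input. -/
lemma integrable_infoDensity {n : ℕ} (ρ : Measure Ω) [IsProbabilityMeasure ρ] (v w : NNReal)
    {X : Ω → Signal n} (hX : Measurable X) (i : Fin n)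
    (hX2 : Integrable (fun ω => X ω i ^ 2) ρ) :
    Integrable (fun p : Ω × Signal n => infoDensity v w (X p.1 i) (p.2 i))
        (ρ.prod (whiteNoise n v)) ∧
      ∫ p : Ω × Signal n, infoDensity v w (X p.1 i) (p.2 i) ∂ρ.prod (whiteNoise n v) =
        1 / 2 * Real.log (w / v) - v / (2 * v) + (∫ ω, X ω i ^ 2 ∂ρ + v) / (2 * w) := by
  have hXi : Measurable fun ω => X ω i := (measurable_pi_apply i).comp hX
  have hX1 : Integrable (fun ω => X ω i) ρ :=
    ((memLp_two_iff_integrable_sq hXi.aestronglyMeasurable).2 hX2).integrable (by norm_num)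
  have hz2 := integrable_sq_whiteNoise v i
  have h1 : Integrable (fun p : Ω × Signal n => X p.1 i ^ 2) (ρ.prod (whiteNoise n v)) :=
    hX2.comp_fst _
  have h2 : Integrable (fun p : Ω × Signal n => p.2 i ^ 2) (ρ.prod (whiteNoise n v)) :=
    hz2.comp_snd _
  have h3 : Integrable (fun p : Ω × Signal n => X p.1 i * p.2 i) (ρ.prod (whiteNoise n v)) :=
    hX1.mul_prod (integrable_eval_whiteNoise v i)
  have e1 : ∫ p : Ω × Signal n, X p.1 i ^ 2 ∂ρ.prod (whiteNoise n v) = ∫ ω, X ω i ^ 2 ∂ρ := by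
    rw [integral_fun_fst (fun ω => X ω i ^ 2)]; simp
  have e2 : ∫ p : Ω × Signal n, p.2 i ^ 2 ∂ρ.prod (whiteNoise n v) = v := by
    rw [integral_fun_snd (fun z : Signal n => z i ^ 2), integral_sq_whiteNoise]; simp
  have e3 : ∫ p : Ω × Signal n, X p.1 i * p.2 i ∂ρ.prod (whiteNoise n v) = 0 := by
    rw [integral_prod_mul (fun ω => X ω i) (fun z : Signal n => z i), integral_eval_whiteNoise,
      mul_zero]
  have hfun : (fun p : Ω × Signal n => infoDensity v w (X p.1 i) (p.2 i)) = fun p =>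
      1 / 2 * Real.log (w / v) - p.2 i ^ 2 / (2 * v)
        + (X p.1 i ^ 2 + 2 * (X p.1 i * p.2 i) + p.2 i ^ 2) / (2 * w) := by
    funext p
    rw [infoDensity]
    ring
  have hc : Integrable (fun _ : Ω × Signal n => 1 / 2 * Real.log ((w : ℝ) / v))
      (ρ.prod (whiteNoise n v)) := integrable_const _
  rw [hfun]
  have hA : Integrable (fun p : Ω × Signal n => 1 / 2 * Real.log (w / v) - p.2 i ^ 2 / (2 * v))
      (ρ.prod (whiteNoise n v)) := hc.sub (h2.div_const _)
  have hB0 : Integrable (fun p : Ω × Signal n => X p.1 i ^ 2 + 2 * (X p.1 i * p.2 i))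
      (ρ.prod (whiteNoise n v)) := h1.add (h3.const_mul 2)
  have hB : Integrable (fun p : Ω × Signal n =>
      (X p.1 i ^ 2 + 2 * (X p.1 i * p.2 i) + p.2 i ^ 2) / (2 * (w : ℝ)))
      (ρ.prod (whiteNoise n v)) := (hB0.add h2).div_const _
  refine ⟨hA.add hB, ?_⟩
  rw [integral_add hA hB, integral_sub hc (h2.div_const _), integral_div, integral_div,
    integral_add hB0 h2, integral_add h1 (h3.const_mul 2), integral_const_mul 2, e1, e2, e3]
  simp

/-- With input energy at most `n P`, the expected information density relative to output noise of
variance `v + P` is at most the capacity of the Gaussian channel, because at this choice of output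
variance the two quadratic terms have a nonpositive total mean. -/
lemma integral_sum_infoDensity_le {n : ℕ} (ρ : Measure Ω) [IsProbabilityMeasure ρ]
    {v : NNReal} (hv : v ≠ 0) (P : NNReal) {X : Ω → Signal n} (hX : Measurable X)
    (hpow : ∫⁻ ω, energy (X ω) ∂ρ ≤ ENNReal.ofReal (n * P)) :
    Integrable (fun p : Ω × Signal n => ∑ i, infoDensity v (v + P) (X p.1 i) (p.2 i))
        (ρ.prod (whiteNoise n v)) ∧
      ∫ p : Ω × Signal n, ∑ i, infoDensity v (v + P) (X p.1 i) (p.2 i) ∂ρ.prod (whiteNoise n v) ≤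
        n * (1 / 2 * Real.log (1 + P / v)) := by
  have hXi : ∀ i, Measurable fun ω => X ω i := fun i => (measurable_pi_apply i).comp hX
  have hsum_nonneg : ∀ ω, 0 ≤ ∑ i, X ω i ^ 2 := fun ω => Finset.sum_nonneg fun i _ => sq_nonneg _
  have hsum : Integrable (fun ω => ∑ i, X ω i ^ 2) ρ := by
    refine ⟨(Finset.measurable_sum _ fun i _ => (hXi i).pow_const 2).aestronglyMeasurable, ?_⟩
    rw [hasFiniteIntegral_iff_ofReal (Eventually.of_forall hsum_nonneg)]
    exact hpow.trans_lt ENNReal.ofReal_lt_top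
  have hX2 : ∀ i, Integrable (fun ω => X ω i ^ 2) ρ := by
    intro i
    refine hsum.mono' ((hXi i).pow_const 2).aestronglyMeasurable (Eventually.of_forall fun ω => ?_)
    rw [Real.norm_of_nonneg (sq_nonneg _)]
    exact Finset.single_le_sum (f := fun i => X ω i ^ 2) (fun i _ => sq_nonneg _)
      (Finset.mem_univ i)
  have henergy : ∑ i, ∫ ω, X ω i ^ 2 ∂ρ ≤ n * P := by
    rw [← integral_finsetSum _ fun i _ => hX2 i]
    rw [← ENNReal.ofReal_le_ofReal_iff (by positivity),
      ofReal_integral_eq_lintegral_ofReal hsum (Eventually.of_forall hsum_nonneg)]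
    exact hpow
  have hD := fun i => integrable_infoDensity ρ v (v + P) hX i (hX2 i)
  refine ⟨integrable_finsetSum _ fun i _ => (hD i).1, ?_⟩
  rw [integral_finsetSum _ fun i _ => (hD i).1, Finset.sum_congr rfl fun i _ => (hD i).2,
    Finset.sum_add_distrib, ← Finset.sum_div, Finset.sum_add_distrib]
  have hv' : (0 : ℝ) < v := by positivity
  have hlog : (((v + P : NNReal) : ℝ)) / v = 1 + P / v := by
    push_cast
    field_simp
  have hw' : (0 : ℝ) < ((v + P : NNReal) : ℝ) := by positivity
  rw [hlog]
  simp only [Finset.sum_const, Finset.card_univ, Fintype.card_fin, nsmul_eq_mul]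
  have h1 : (∑ i, ∫ ω, X ω i ^ 2 ∂ρ + n * (v : ℝ)) / (2 * ((v + P : NNReal) : ℝ)) ≤ n / 2 := by
    rw [div_le_iff₀ (by positivity)]
    push_cast
    nlinarith
  have h2 : (v : ℝ) / (2 * v) = 1 / 2 := by field_simp
  rw [h2]
  linarith

/-! ### Converse for one receiver -/

/-- Weak converse for the Gaussian channel. A receiver decides correctly when the channel output
`y` satisfies `(ω, y) ∈ E`; if an output `y` that is independent of `ω` does so with probability at
most `1 / K`, then the probability of a correct decision over the channel is limited by the
capacity. -/
theorem log_mul_measureReal_le {n : ℕ} (ρ : Measure Ω) [IsProbabilityMeasure ρ]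
    {v : NNReal} (hv : v ≠ 0) (P : NNReal) {X : Ω → Signal n} (hX : Measurable X)
    (hpow : ∫⁻ ω, energy (X ω) ∂ρ ≤ ENNReal.ofReal (n * P))
    {E : Set (Ω × Signal n)} (hE : MeasurableSet E) {K : ℝ} (hK : 0 < K)
    (hguess : ∀ y, ρ {ω | (ω, y) ∈ E} ≤ (ENNReal.ofReal K)⁻¹) :
    Real.log K * (ρ.prod (whiteNoise n v)).real {p | (p.1, X p.1 + p.2) ∈ E} ≤
      n * (1 / 2 * Real.log (1 + P / v)) + Real.log 2 := by
  have hw : v + P ≠ 0 := by positivity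
  -- `out p` records, next to `ω`, the channel output.
  let out : Ω × Signal n → Ω × Signal n := fun p => (p.1, X p.1 + p.2)
  have hout : Measurable out :=
    measurable_fst.prodMk ((hX.comp measurable_fst).add measurable_snd)
  let L : Ω × Signal n → ℝ := fun p => ∑ i, infoDensity v (v + P) (X p.1 i) (p.2 i)
  have hLm : Measurable L :=
    measurable_sum_infoDensity v (v + P) (hX.comp measurable_fst) measurable_snd
  obtain ⟨hLint, hLle⟩ : Integrable L (ρ.prod (whiteNoise n v)) ∧
      ∫ p, L p ∂ρ.prod (whiteNoise n v) ≤ n * (1 / 2 * Real.log (1 + P / v)) :=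
    integral_sum_infoDensity_le ρ hv P hX hpow
  -- The test function `exp f` is `K` on correct decisions and `1` elsewhere.
  let f : Ω × Signal n → ℝ := E.indicator fun _ => Real.log K
  have hf : Measurable f := measurable_const.indicator hE
  let G : Ω × Signal n → ENNReal := fun q => ENNReal.ofReal (Real.exp (f q))
  have hG : Measurable G := ENNReal.measurable_ofReal.comp (Real.measurable_exp.comp hf)
  have hG2 : ∀ y, ∫⁻ ω, G (ω, y) ∂ρ ≤ 2 := by
    intro y
    have hEy : MeasurableSet {ω | (ω, y) ∈ E} := measurable_prodMk_right hE
    calc ∫⁻ ω, G (ω, y) ∂ρ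
        ≤ ∫⁻ ω, 1 + {ω | (ω, y) ∈ E}.indicator (fun _ => ENNReal.ofReal K) ω ∂ρ := by
          refine lintegral_mono fun ω => ?_
          by_cases h : (ω, y) ∈ E <;> simp [G, f, h, Real.exp_log hK]
      _ = 1 + ENNReal.ofReal K * ρ {ω | (ω, y) ∈ E} := by
          rw [lintegral_add_left measurable_const, lintegral_indicator_const hEy]
          simp
      _ ≤ 1 + ENNReal.ofReal K * (ENNReal.ofReal K)⁻¹ := by gcongr; exact hguess y
      _ ≤ 2 := by
          rw [ENNReal.mul_inv_cancel (by simpa using hK) ENNReal.ofReal_ne_top, one_add_one_eq_two]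
  have hchange : ∫⁻ p, G (out p) * ENNReal.ofReal (Real.exp (-L p)) ∂ρ.prod (whiteNoise n v)
      ≤ 2 := by
    have hm : Measurable fun p => G (out p) * ENNReal.ofReal (Real.exp (-L p)) :=
      (hG.comp hout).mul (ENNReal.measurable_ofReal.comp (Real.measurable_exp.comp hLm.neg))
    rw [lintegral_prod _ hm.aemeasurable]
    calc ∫⁻ ω, ∫⁻ z, G (out (ω, z)) * ENNReal.ofReal (Real.exp (-L (ω, z))) ∂whiteNoise n v ∂ρ
        = ∫⁻ ω, ∫⁻ y, G (ω, y) ∂whiteNoise n (v + P) ∂ρ :=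
          lintegral_congr fun ω => lintegral_exp_neg_infoDensity hv hw (X ω) (fun y => G (ω, y))
            (hG.comp measurable_prodMk_left)
      _ = ∫⁻ y, ∫⁻ ω, G (ω, y) ∂ρ ∂whiteNoise n (v + P) :=
          lintegral_lintegral_swap hG.aemeasurable
      _ ≤ ∫⁻ _, 2 ∂whiteNoise n (v + P) := lintegral_mono hG2
      _ = 2 := by simp
  have hFint : Integrable (fun p => f (out p)) (ρ.prod (whiteNoise n v)) := by
    have : (fun p => f (out p)) = (out ⁻¹' E).indicator fun _ => Real.log K := rfl
    rw [this]
    exact (integrable_const _).indicator (hout hE)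
  have hFval : ∫ p, f (out p) ∂ρ.prod (whiteNoise n v)
      = Real.log K * (ρ.prod (whiteNoise n v)).real (out ⁻¹' E) := by
    have : (fun p => f (out p)) = (out ⁻¹' E).indicator fun _ => Real.log K := rfl
    rw [this, integral_indicator_const _ (hout hE), smul_eq_mul, mul_comm]
  have hexp_lint : ∫⁻ p, ENNReal.ofReal (Real.exp (f (out p) - L p)) ∂ρ.prod (whiteNoise n v)
      ≤ 2 := by
    refine le_trans (le_of_eq (lintegral_congr fun p => ?_)) hchange
    rw [sub_eq_add_neg, Real.exp_add, ENNReal.ofReal_mul (Real.exp_pos _).le]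
  have hexp_meas : Measurable fun p => Real.exp (f (out p) - L p) :=
    Real.measurable_exp.comp ((hf.comp hout).sub hLm)
  have hexp_int : Integrable (fun p => Real.exp (f (out p) - L p)) (ρ.prod (whiteNoise n v)) := by
    refine ⟨hexp_meas.aestronglyMeasurable, ?_⟩
    rw [hasFiniteIntegral_iff_ofReal (Eventually.of_forall fun p => (Real.exp_pos _).le)]
    exact hexp_lint.trans_lt (by simp)
  have hexp_le : ∫ p, Real.exp (f (out p) - L p) ∂ρ.prod (whiteNoise n v) ≤ 2 := by
    rw [integral_eq_lintegral_of_nonneg_ae (Eventually.of_forall fun p => (Real.exp_pos _).le)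
      hexp_meas.aestronglyMeasurable]
    exact ENNReal.toReal_le_of_le_ofReal (by norm_num) (by simpa using hexp_lint)
  -- Tangent line of `exp` at `log 2` in place of Jensen's inequality.
  have hmono : ∫ p, ((f (out p) - L p) + (1 - Real.log 2)) ∂ρ.prod (whiteNoise n v)
      ≤ ∫ p, 1 / 2 * Real.exp (f (out p) - L p) ∂ρ.prod (whiteNoise n v) := by
    refine integral_mono ((hFint.sub hLint).add (integrable_const _)) (hexp_int.const_mul _)
      fun p => ?_
    have h := Real.add_one_le_exp (f (out p) - L p - Real.log 2)
    rw [Real.exp_sub _ (Real.log 2), Real.exp_log two_pos] at h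
    change f (out p) - L p + (1 - Real.log 2) ≤ 1 / 2 * Real.exp (f (out p) - L p)
    linarith
  have hFL : Integrable (fun p => f (out p) - L p) (ρ.prod (whiteNoise n v)) := hFint.sub hLint
  rw [integral_add hFL (integrable_const _), integral_sub hFint hLint, hFval,
    integral_const_mul] at hmono
  simp only [integral_const, probReal_univ, one_smul] at hmono
  change Real.log K * (ρ.prod (whiteNoise n v)).real (out ⁻¹' E) ≤ _
  linarith

/-! ### From the relay network to the broadcast link to node `B` -/

instance isProbabilityMeasure_msgLaw (k : ℕ) : IsProbabilityMeasure (msgLaw k) :=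
  PMF.toMeasure.isProbabilityMeasure _

instance isProbabilityMeasure_noiseLaw (n : ℕ) (σ : ℝ) : IsProbabilityMeasure (noiseLaw n σ) := by
  unfold noiseLaw
  infer_instance

lemma msgLaw_singleton (k : ℕ) (m : Msg k) : msgLaw k {m} = (ENNReal.ofReal (2 ^ k))⁻¹ := by
  rw [msgLaw, PMF.toMeasure_apply_singleton _ _ (measurableSet_singleton m),
    PMF.uniformOfFintype_apply, ENNReal.ofReal_pow zero_le_two]
  simp

namespace ExchangeCode

variable {n k : ℕ} (c : ExchangeCode n k)

/-- Everything that precedes the noise at node `B`: seed, messages, and noise at the relay. -/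
abbrev Upstream : Type := c.Seed × (Msg k × Msg k) × Signal n

/-- The law of the seed, the messages, and the noise at the relay. -/
noncomputable def upstreamLaw (σ : ℝ) : Measure c.Upstream :=
  c.seedLaw.prod (((msgLaw k).prod (msgLaw k)).prod (noiseLaw n σ))

instance isProbabilityMeasure_upstreamLaw (σ : ℝ) :
    IsProbabilityMeasure (c.upstreamLaw σ) := by
  unfold upstreamLaw
  infer_instance

instance isProbabilityMeasure_law (σ : ℝ) : IsProbabilityMeasure (c.law σ) := by
  unfold law
  infer_instance

/-- The input of the broadcast channel as a function of the upstream data. -/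
def broadcastInput (ω : c.Upstream) : Signal n :=
  c.relay ω.1 (c.encA ω.1 ω.2.1.1 + c.encB ω.1 ω.2.1.2 + ω.2.2)

/-- The pairs of upstream data and received block for which node `B` decides correctly. -/
def correctB : Set (c.Upstream × Signal n) :=
  {q | q.1.2.1.1 = c.decB q.1.1 q.1.2.1.2 q.2}

lemma measurable_broadcastInput : Measurable c.broadcastInput := by
  have hA : Measurable fun ω : c.Upstream => c.encA ω.1 ω.2.1.1 :=
    c.measurable_encA.comp (f := fun ω : c.Upstream => (ω.1, ω.2.1.1)) (by fun_prop)
  have hB : Measurable fun ω : c.Upstream => c.encB ω.1 ω.2.1.2 :=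
    c.measurable_encB.comp (f := fun ω : c.Upstream => (ω.1, ω.2.1.2)) (by fun_prop)
  exact c.measurable_relay.comp
    (measurable_fst.prodMk ((hA.add hB).add (measurable_snd.comp measurable_snd)))

lemma measurableSet_correctB : MeasurableSet c.correctB := by
  have hB : Measurable fun q : c.Upstream × Signal n => c.decB q.1.1 q.1.2.1.2 q.2 :=
    c.measurable_decB.comp
      (f := fun q : c.Upstream × Signal n => (q.1.1, q.1.2.1.2, q.2)) (by fun_prop)
  exact measurableSet_eq_fun (f := fun q : c.Upstream × Signal n => q.1.2.1.1) (by fun_prop) hB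

/-- Dropping the noise at node `A` leaves independent upstream data and noise at node `B`. -/
lemma measurePreserving_upstream (σ : ℝ) :
    MeasurePreserving (fun ω : c.Outcome => (((ω.1, ω.2.1, ω.2.2.1), ω.2.2.2.2) :
      c.Upstream × Signal n)) (c.law σ) ((c.upstreamLaw σ).prod (noiseLaw n σ)) := by
  have h1 : MeasurePreserving (Prod.snd : Signal n × Signal n → Signal n)
      ((noiseLaw n σ).prod (noiseLaw n σ)) (noiseLaw n σ) := measurePreserving_snd
  have h2 := (MeasurePreserving.id c.seedLaw).prod
    ((MeasurePreserving.id ((msgLaw k).prod (msgLaw k))).prod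
      ((MeasurePreserving.id (noiseLaw n σ)).prod h1))
  have h3 := (MeasurePreserving.id c.seedLaw).prod
    (measurePreserving_prodAssoc ((msgLaw k).prod (msgLaw k)) (noiseLaw n σ) (noiseLaw n σ)).symm
  have h4 := (measurePreserving_prodAssoc c.seedLaw
    (((msgLaw k).prod (msgLaw k)).prod (noiseLaw n σ)) (noiseLaw n σ)).symm
  exact h4.comp (h3.comp h2)

/-- A received block that is independent of the messages lets node `B` only guess: the message of
`A` is uniform and independent of the seed and of the message of `B`. -/
lemma upstreamLaw_guess_le (σ : ℝ) (y : Signal n) :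
    c.upstreamLaw σ {ω | (ω, y) ∈ c.correctB} ≤ (ENNReal.ofReal (2 ^ k))⁻¹ := by
  have hm : MeasurableSet {ω | (ω, y) ∈ c.correctB} :=
    measurable_prodMk_right c.measurableSet_correctB
  rw [upstreamLaw, Measure.prod_apply hm]
  refine (lintegral_mono fun s => ?_).trans_eq
    ((lintegral_const _).trans (by rw [measure_univ, mul_one]))
  have hset : Prod.mk s ⁻¹' {ω : c.Upstream | (ω, y) ∈ c.correctB}
      = {m : Msg k × Msg k | m.1 = c.decB s m.2 y} ×ˢ Set.univ := by
    ext p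
    simp [correctB]
  rw [hset, Measure.prod_prod, measure_univ, mul_one,
    Measure.prod_apply_symm (Set.toFinite _).measurableSet]
  refine (lintegral_mono fun b => ?_).trans_eq
    ((lintegral_const _).trans (by rw [measure_univ, mul_one]))
  exact (msgLaw_singleton k (c.decB s b y)).le

/-- Weak converse at finite block length: `k (1 - P_e) ≤ n C + 1`, where `C` is the capacity of the
broadcast link in bits per channel use. -/
lemma mul_one_sub_errorProb_le {P σ : ℝ} (hP : 0 ≤ P) (hσ : 0 < σ) (hc : c.PowerConstrained P σ) :
    k * (1 - (c.errorProb σ).toReal) ≤ n * (1 / 2 * Real.logb 2 (1 + P / σ ^ 2)) + 1 := by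
  have hφ := c.measurePreserving_upstream σ
  have hS : MeasurableSet {p : c.Upstream × Signal n |
      (p.1, c.broadcastInput p.1 + p.2) ∈ c.correctB} :=
    (measurable_fst.prodMk ((c.measurable_broadcastInput.comp measurable_fst).add measurable_snd))
      c.measurableSet_correctB
  have henergy : Measurable (energy (n := n)) := by
    unfold energy
    fun_prop
  have hpow : ∫⁻ ω, energy (c.broadcastInput ω) ∂c.upstreamLaw σ
      ≤ ENNReal.ofReal (n * P.toNNReal) := by
    have h := (measurePreserving_fst (μ := c.upstreamLaw σ) (ν := noiseLaw n σ)).comp hφ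
    rw [← h.lintegral_comp (f := fun ω => energy (c.broadcastInput ω))
      (henergy.comp c.measurable_broadcastInput), Real.coe_toNNReal P hP]
    exact hc.2.2
  have hσ2 : (σ ^ 2).toNNReal ≠ 0 := (Real.toNNReal_pos.2 (by positivity)).ne'
  have hmain := log_mul_measureReal_le (c.upstreamLaw σ) hσ2 P.toNNReal
    c.measurable_broadcastInput hpow c.measurableSet_correctB (K := 2 ^ k) (by positivity)
    (c.upstreamLaw_guess_le σ)
  rw [Real.coe_toNNReal P hP, Real.coe_toNNReal _ (sq_nonneg σ), Real.log_pow] at hmain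
  have hcorrect : ((c.upstreamLaw σ).prod (noiseLaw n σ)).real
      {p | (p.1, c.broadcastInput p.1 + p.2) ∈ c.correctB}
      = 1 - (c.law σ).real {ω | c.uA ω ≠ c.estA ω} := by
    rw [← hφ.measureReal_preimage hS.nullMeasurableSet, ← probReal_compl_eq_one_sub]
    · congr 1
      ext ω
      simp only [Set.mem_preimage, Set.mem_ofPred_eq, Set.mem_compl_iff, not_not]
      rfl
    · exact (hφ.measurable hS).compl
  have herr : (c.law σ).real {ω | c.uA ω ≠ c.estA ω} ≤ (c.errorProb σ).toReal :=
    measureReal_mono Set.subset_union_left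
  change (k * Real.log 2) * ((c.upstreamLaw σ).prod (noiseLaw n σ)).real
    {p | (p.1, c.broadcastInput p.1 + p.2) ∈ c.correctB} ≤ _ at hmain
  rw [hcorrect] at hmain
  have hlog2 : 0 < Real.log 2 := Real.log_pos one_lt_two
  rw [Real.logb, ← mul_le_mul_iff_left₀ hlog2]
  calc k * (1 - (c.errorProb σ).toReal) * Real.log 2
      ≤ k * (1 - (c.law σ).real {ω | c.uA ω ≠ c.estA ω}) * Real.log 2 := by gcongr
    _ ≤ n * (1 / 2 * Real.log (1 + P / σ ^ 2)) + Real.log 2 := by linarith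
    _ = _ := by field_simp

end ExchangeCode

end BidirectionalRelay

theorem mainTheorem5 (P σ : ℝ) (hP : 0 ≤ P) (hσ : 0 < σ) :
    BidirectionalRelay.exchangeCapacity P σ ≤
      ((1 / 2 * Real.logb 2 (1 + P / σ ^ 2) : ℝ) : EReal) := by
  -- By the finite-length bound `k n / n` is at most `(C + 1 / n) / (1 - P_e)`, which tends to `C`.
  refine iSup_le fun S => iSup_le fun k => iSup_le fun herr => ?_
  set C : ℝ := 1 / 2 * Real.logb 2 (1 + P / σ ^ 2)
  have hε : Tendsto (fun n => ((S.code n (k n)).errorProb σ).toReal) atTop (𝓝 0) :=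
    (ENNReal.tendsto_toReal ENNReal.zero_ne_top).comp herr
  have hlim : Tendsto (fun n : ℕ => (C + 1 / (n : ℝ)) /
      (1 - ((S.code n (k n)).errorProb σ).toReal)) atTop (𝓝 C) := by
    have h := ((tendsto_const_nhds (x := C)).add tendsto_one_div_atTop_nhds_zero_nat).div
      ((tendsto_const_nhds (x := (1 : ℝ))).sub hε) (by norm_num)
    simpa [Pi.div_def] using h
  have hle : ∀ᶠ n : ℕ in atTop, (((k n : ℝ) / (n : ℝ) : ℝ) : EReal) ≤
      (((C + 1 / (n : ℝ)) / (1 - ((S.code n (k n)).errorProb σ).toReal) : ℝ) : EReal) := by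
    filter_upwards [hε.eventually_lt_const one_pos, eventually_gt_atTop 0] with n hn hn0
    have hn0' : (0 : ℝ) < n := Nat.cast_pos.2 hn0
    rw [EReal.coe_le_coe_iff, le_div_iff₀ (sub_pos.2 hn), div_mul_eq_mul_div, div_le_iff₀ hn0',
      add_mul, one_div_mul_cancel hn0'.ne', mul_comm C]
    exact (S.code n (k n)).mul_one_sub_errorProb_le hP hσ (S.power n (k n))
  have hlim' := (continuous_coe_real_ereal.tendsto C).comp hlim
  exact (liminf_le_liminf hle).trans_eq hlim'.liminf_eq
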